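/- Let $\varepsilon\in\{-1,1\}$. A Lorentzian almost contact ($\varepsilon=-1$), respectively almost paracontact ($\varepsilon=1$), manifold is a smooth manifold $M$ of dimension $2m+1$ with a Lorentzian metric $g_M$ (a semi-Riemannian metric of index $1$), a smooth $(1,1)$-tensor field $\phi$, a smooth vector field $\xi$ and a smooth $1$-form $\eta$ such that for all tangent vectors $X,Y$ $$\phi^2X=\varepsilon X+\eta(X)\xi,\quad g_M(\phi X,\phi Y)=g_M(X,Y)+\eta(X)\eta(Y),\quad \eta(X)=\varepsilon g_M(X,\xi),\quad \eta(\xi)=-\varepsilon .$$ It is called $K$-contact ($\varepsilon=-1$), respectively $K$-paracontact ($\varepsilon=1$), if moreover $d\eta(X,Y)=g_M(X,\phi Y)$ for all vector fields $X,Y$, where $2\,d\eta(X,Y)=X(\eta(Y))-Y(\eta(X))-\eta([X,Y])$, and $\xi$ is a Killing vector field of $g_M$. (For $\varepsilon=1$ the right-hand side $g_M(X,\phi Y)$ is symmetric in $X,Y$, so that these conditions can hold only if $m=0$.) A semi-Riemannian submersion $F:(M,g_M)\to(N,g_N)$ between semi-Riemannian manifolds is a smooth submersion whose fibres are semi-Riemannian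 submanifolds of $M$ and for which $g_N(F_*X,F_*Y)=g_M(X,Y)$ for all $X,Y\in(\ker F_*)^\perp$. It is called anti-invariant if $\phi(\ker F_*)\subseteq(\ker F_*)^\perp$. **Theorem.** Let $F$ be a semi-Riemannian submersion from a (non-empty) $K$-contact or $K$-paracontact manifold $M(\phi,\xi,\eta,g_M)$ of dimension $2m+1$ onto a semi-Riemannian manifold $(N,g_N)$ of dimension $n$. If $\xi$ is horizontal, that is, $\xi_p\in(\ker F_{*p})^\perp$ for every $p\in M$, then $F$ is an anti-invariant submersion and $m+1\le n$. -/

import Mathlib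

open scoped Manifold ContDiff Bundle

noncomputable section

/-- The tangent space at `p` of a manifold modelled on `ℝ^d`. -/
abbrev Tan (d : ℕ) {M : Type*} [TopologicalSpace M] [ChartedSpace (EuclideanSpace ℝ (Fin d)) M]
    (p : M) : Type :=
  TangentSpace (𝓡 d) p

/-- A semi-Riemannian metric on a smooth `d`-dimensional manifold: a smooth symmetric
nondegenerate `(0,2)`-tensor field of constant index. The index at a point is the maximal
dimension of a negative definite subspace of the tangent space. -/
structure SemiRiemannianMetric (d : ℕ) (M : Type*) [TopologicalSpace M]
    [ChartedSpace (EuclideanSpace ℝ (Fin d)) M] [IsManifold (𝓡 d) ∞ M] where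
  /-- The scalar product on each tangent space. -/
  val (p : M) : Tan d p →L[ℝ] Tan d p →L[ℝ] ℝ
  symm (p : M) (v w : Tan d p) : val p v w = val p w v
  nondegenerate (p : M) (v : Tan d p) (hv : ∀ w : Tan d p, val p v w = 0) : v = 0
  /-- The common index of all the scalar products. -/
  index : ℕ
  sigNeg_eq (p : M) :
    sigNeg (LinearMap.BilinMap.toQuadraticMap (val p).toBilinForm) = index
  contMDiff : ContMDiff (𝓡 d)
    ((𝓡 d).prod 𝓘(ℝ, EuclideanSpace ℝ (Fin d) →L[ℝ] EuclideanSpace ℝ (Fin d) →L[ℝ] ℝ)) ∞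
    (fun p : M ↦ Bundle.TotalSpace.mk'
      (EuclideanSpace ℝ (Fin d) →L[ℝ] EuclideanSpace ℝ (Fin d) →L[ℝ] ℝ)
      (E := fun q : M ↦ (Tan d q →L[ℝ] Tan d q →L[ℝ] ℝ)) p (val p))

section VectorFields

variable {d : ℕ} {M : Type*} [TopologicalSpace M] [ChartedSpace (EuclideanSpace ℝ (Fin d)) M]
  [IsManifold (𝓡 d) ∞ M]

/-- The (rough) vector field `X` is smooth at the point `p`. -/
def SmoothFieldAt (X : (q : M) → Tan d q) (p : M) : Prop :=
  ContMDiffAt (𝓡 d) (𝓡 d).tangent ∞ (fun q : M ↦ (⟨q, X q⟩ : TangentBundle (𝓡 d) M)) p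

/-- The directional derivative at `p` of the function `f` along the tangent vector `v`. -/
def dirDeriv (f : M → ℝ) (p : M) (v : Tan d p) : ℝ := mvfderiv (𝓡 d) f p v

/-- The exterior derivative of a `1`-form, evaluated at `p` on the vector fields `X` and `Y`, in
the normalization `2 dη(X, Y) = X(η(Y)) - Y(η(X)) - η([X, Y])` of contact geometry. -/
def extDerivOneForm (η : (q : M) → Tan d q →L[ℝ] ℝ) (X Y : (q : M) → Tan d q) (p : M) : ℝ :=
  (1 / 2) * (dirDeriv (fun q ↦ η q (Y q)) p (X p) - dirDeriv (fun q ↦ η q (X q)) p (Y p)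
    - η p (VectorField.mlieBracket (𝓡 d) X Y p))

/-- `ξ` is a Killing vector field: the Lie derivative of the metric along `ξ` vanishes, that is
`ξ(g(X, Y)) = g([ξ, X], Y) + g(X, [ξ, Y])` at each point `p`, for all vector fields `X`, `Y` that
are smooth at `p`. -/
def IsKillingField (g : SemiRiemannianMetric d M) (ξ : (q : M) → Tan d q) : Prop :=
  ∀ (p : M) (X Y : (q : M) → Tan d q), SmoothFieldAt X p → SmoothFieldAt Y p →
    dirDeriv (fun q ↦ g.val q (X q) (Y q)) p (ξ p) =
      g.val p (VectorField.mlieBracket (𝓡 d) ξ X p) (Y p) +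
        g.val p (X p) (VectorField.mlieBracket (𝓡 d) ξ Y p)

/-- `(φ, ξ, η, g)` is a Lorentzian almost contact structure if `ε = -1`, and a Lorentzian almost
paracontact structure if `ε = 1`. -/
structure IsLorentzianAlmostContact (ε : ℝ) (φ : (q : M) → Tan d q →L[ℝ] Tan d q)
    (ξ : (q : M) → Tan d q) (η : (q : M) → Tan d q →L[ℝ] ℝ) (g : SemiRiemannianMetric d M) :
    Prop where
  lorentzian : g.index = 1
  smooth_phi : ContMDiff (𝓡 d)
    ((𝓡 d).prod 𝓘(ℝ, EuclideanSpace ℝ (Fin d) →L[ℝ] EuclideanSpace ℝ (Fin d))) ∞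
    (fun p : M ↦ Bundle.TotalSpace.mk' (EuclideanSpace ℝ (Fin d) →L[ℝ] EuclideanSpace ℝ (Fin d))
      (E := fun q : M ↦ (Tan d q →L[ℝ] Tan d q)) p (φ p))
  smooth_xi : ∀ p, SmoothFieldAt ξ p
  smooth_eta : ContMDiff (𝓡 d) ((𝓡 d).prod 𝓘(ℝ, EuclideanSpace ℝ (Fin d) →L[ℝ] ℝ)) ∞
    (fun p : M ↦ Bundle.TotalSpace.mk' (EuclideanSpace ℝ (Fin d) →L[ℝ] ℝ)
      (E := fun q : M ↦ (Tan d q →L[ℝ] ℝ)) p (η p))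
  phi_phi : ∀ (p : M) (v : Tan d p), φ p (φ p v) = ε • v + η p v • ξ p
  metric_phi : ∀ (p : M) (v w : Tan d p),
    g.val p (φ p v) (φ p w) = g.val p v w + η p v * η p w
  eta_eq : ∀ (p : M) (v : Tan d p), η p v = ε * g.val p v (ξ p)
  eta_xi : ∀ p : M, η p (ξ p) = -ε

/-- A `K`-contact (`ε = -1`) or `K`-paracontact (`ε = 1`) structure: a Lorentzian almost
(para)contact structure with `dη = Φ`, where `Φ(X, Y) = g(X, φ Y)`, whose characteristic vector
field `ξ` is Killing. -/
structure IsKContact (ε : ℝ) (φ : (q : M) → Tan d q →L[ℝ] Tan d q)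
    (ξ : (q : M) → Tan d q) (η : (q : M) → Tan d q →L[ℝ] ℝ) (g : SemiRiemannianMetric d M) :
    Prop extends IsLorentzianAlmostContact ε φ ξ η g where
  contact : ∀ (p : M) (X Y : (q : M) → Tan d q), SmoothFieldAt X p → SmoothFieldAt Y p →
    extDerivOneForm η X Y p = g.val p (X p) (φ p (Y p))
  killing : IsKillingField g ξ

end VectorFields

section Submersions

variable {d n : ℕ} {M N : Type*}
  [TopologicalSpace M] [ChartedSpace (EuclideanSpace ℝ (Fin d)) M] [IsManifold (𝓡 d) ∞ M]
  [TopologicalSpace N] [ChartedSpace (EuclideanSpace ℝ (Fin n)) N] [IsManifold (𝓡 n) ∞ N]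

/-- The vertical vectors at `p`: the kernel of the differential `F_*` at `p`, which is the tangent
space of the fibre through `p` when `F` is a submersion. -/
def verticalSpace (d n : ℕ) {M N : Type*}
    [TopologicalSpace M] [ChartedSpace (EuclideanSpace ℝ (Fin d)) M]
    [TopologicalSpace N] [ChartedSpace (EuclideanSpace ℝ (Fin n)) N]
    (F : M → N) (p : M) : Set (Tan d p) :=
  {v | mfderiv (𝓡 d) (𝓡 n) F p v = 0}

/-- The horizontal vectors at `p`: those orthogonal to all vertical vectors. -/
def horizontalSpace (n : ℕ) {N : Type*} [TopologicalSpace N]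
    [ChartedSpace (EuclideanSpace ℝ (Fin n)) N]
    (g : SemiRiemannianMetric d M) (F : M → N) (p : M) : Set (Tan d p) :=
  {v | ∀ w ∈ verticalSpace d n F p, g.val p v w = 0}

/-- A semi-Riemannian submersion: a smooth submersion whose fibres are semi-Riemannian
submanifolds (the metric is nondegenerate on each of their tangent spaces; the index is then
constant along each fibre because it is constant on `M` and on `N`) and whose differential
preserves the scalar products of horizontal vectors. -/
structure IsSemiRiemannianSubmersion (gM : SemiRiemannianMetric d M)
    (gN : SemiRiemannianMetric n N) (F : M → N) : Prop where
  contMDiff : ContMDiff (𝓡 d) (𝓡 n) ∞ F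
  surjective_mfderiv : ∀ p : M, Function.Surjective (mfderiv (𝓡 d) (𝓡 n) F p)
  fibre_nondegenerate : ∀ p : M, ∀ v ∈ verticalSpace d n F p,
    (∀ w ∈ verticalSpace d n F p, gM.val p v w = 0) → v = 0
  isometric : ∀ p : M, ∀ v ∈ horizontalSpace n gM F p, ∀ w ∈ horizontalSpace n gM F p,
    gN.val (F p) (mfderiv (𝓡 d) (𝓡 n) F p v) (mfderiv (𝓡 d) (𝓡 n) F p w) = gM.val p v w

/-- An anti-invariant semi-Riemannian submersion: `φ` maps vertical vectors to horizontal ones. -/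
structure IsAntiInvariantSubmersion (φ : (q : M) → Tan d q →L[ℝ] Tan d q)
    (gM : SemiRiemannianMetric d M) (gN : SemiRiemannianMetric n N) (F : M → N) : Prop extends
    IsSemiRiemannianSubmersion gM gN F where
  anti_invariant : ∀ p : M, Set.MapsTo (φ p) (verticalSpace d n F p) (horizontalSpace n gM F p)

end Submersions

end

open Filter Topology VectorField

/-- A map into a vector space whose differential at `p` is surjective is linear near `p` in
suitable smooth coordinates `Ψ`. -/
theorem exists_coordinates_comp_eq {d n : ℕ} {M : Type*} [TopologicalSpace M]
    [ChartedSpace (EuclideanSpace ℝ (Fin d)) M] [IsManifold (𝓡 d) ∞ M]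
    {f : M → EuclideanSpace ℝ (Fin n)} {p : M}
    (hf : ContMDiffAt (𝓡 d) 𝓘(ℝ, EuclideanSpace ℝ (Fin n)) ∞ f p)
    (hsurj : Function.Surjective (mfderiv (𝓡 d) 𝓘(ℝ, EuclideanSpace ℝ (Fin n)) f p)) :
    ∃ (Ψ : M → EuclideanSpace ℝ (Fin d))
      (A : EuclideanSpace ℝ (Fin d) →L[ℝ] EuclideanSpace ℝ (Fin n)),
      ContMDiffAt (𝓡 d) 𝓘(ℝ, EuclideanSpace ℝ (Fin d)) ∞ Ψ p ∧
      (mfderiv (𝓡 d) 𝓘(ℝ, EuclideanSpace ℝ (Fin d)) Ψ p).IsInvertible ∧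
      ∀ q, A (Ψ q) = f q := by
  set c := extChartAt (𝓡 d) p
  have hc : ContMDiffAt (𝓡 d) 𝓘(ℝ, EuclideanSpace ℝ (Fin d)) ∞ c p := contMDiffAt_extChartAt
  obtain ⟨e, he⟩ := isInvertible_mfderiv_extChartAt (I := 𝓡 d) (mem_extChartAt_source p)
  let e' : EuclideanSpace ℝ (Fin d) ≃L[ℝ] EuclideanSpace ℝ (Fin d) := e
  let D : EuclideanSpace ℝ (Fin d) →L[ℝ] EuclideanSpace ℝ (Fin n) :=
    mfderiv (𝓡 d) 𝓘(ℝ, EuclideanSpace ℝ (Fin n)) f p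
  let A := D ∘L (e'.symm : EuclideanSpace ℝ (Fin d) →L[ℝ] EuclideanSpace ℝ (Fin d))
  have hA : Function.Surjective A := hsurj.comp e'.symm.surjective
  obtain ⟨R, hR⟩ := A.exists_rightInverse_of_surjective (LinearMap.range_eq_top.2 hA)
  have hAR (y) : A (R y) = y := DFunLike.congr_fun hR y
  have hf' : HasMFDerivAt (𝓡 d) 𝓘(ℝ, EuclideanSpace ℝ (Fin n)) f p D :=
    (hf.mdifferentiableAt (by simp)).hasMFDerivAt
  have hc' : HasMFDerivAt (𝓡 d) 𝓘(ℝ, EuclideanSpace ℝ (Fin d)) c p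
      (e' : EuclideanSpace ℝ (Fin d) →L[ℝ] EuclideanSpace ℝ (Fin d)) := by
    have := (hc.mdifferentiableAt (by simp)).hasMFDerivAt
    rwa [← he] at this
  refine ⟨fun q ↦ c q + R (f q - A (c q)), A, ?_, ?_, fun q ↦ ?_⟩
  · exact hc.add (R.contMDiff.contMDiffAt.comp p
      (hf.sub (A.contMDiff.contMDiffAt.comp p hc)))
  · have h₁ : HasMFDerivAt (𝓡 d) 𝓘(ℝ, EuclideanSpace ℝ (Fin n)) (A ∘ c) p D := by
      refine (A.hasMFDerivAt.comp p hc').congr_mfderiv ?_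
      ext1 v
      exact congrArg D (e'.symm_apply_apply v)
    have h₂ : HasMFDerivAt (𝓡 d) 𝓘(ℝ, EuclideanSpace ℝ (Fin n)) (f - A ∘ c) p
        (0 : EuclideanSpace ℝ (Fin d) →L[ℝ] EuclideanSpace ℝ (Fin n)) := by
      exact (hf'.sub h₁).congr_mfderiv (sub_self D)
    have h₃ : HasMFDerivAt (𝓡 d) 𝓘(ℝ, EuclideanSpace ℝ (Fin d)) (R ∘ (f - A ∘ c)) p
        (0 : EuclideanSpace ℝ (Fin d) →L[ℝ] EuclideanSpace ℝ (Fin d)) := by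
      exact (R.hasMFDerivAt.comp p h₂).congr_mfderiv (ContinuousLinearMap.comp_zero R)
    have h₄ := (hc'.add h₃).congr_mfderiv
      (add_zero (e' : EuclideanSpace ℝ (Fin d) →L[ℝ] EuclideanSpace ℝ (Fin d)))
    exact ⟨e, h₄.mfderiv.symm⟩
  · rw [map_add, hAR]
    abel

/-- The constant vector field on `ℝ^d` with value `u`. -/
def constantField {d : ℕ} (u : EuclideanSpace ℝ (Fin d)) (x : EuclideanSpace ℝ (Fin d)) :
    Tan d x := u

theorem mlieBracket_constantField {d : ℕ} (u v x : EuclideanSpace ℝ (Fin d)) :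
    mlieBracket 𝓘(ℝ, EuclideanSpace ℝ (Fin d)) (constantField u) (constantField v) x = 0 := by
  rw [← mlieBracketWithin_univ, mlieBracketWithin_eq_lieBracketWithin]
  change lieBracketWithin ℝ (fun _ : EuclideanSpace ℝ (Fin d) ↦ u) (fun _ ↦ v) Set.univ x = 0
  simp [lieBracket]

theorem dirDeriv_eq_zero_of_eventually {d : ℕ} {M : Type*} [TopologicalSpace M]
    [ChartedSpace (EuclideanSpace ℝ (Fin d)) M] {f : M → ℝ} {p : M}
    (hf : ∀ᶠ q in 𝓝 p, f q = 0)
    (v : Tan d p) : dirDeriv f p v = 0 := by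
  have h : f =ᶠ[𝓝 p] fun _ ↦ (0 : ℝ) := hf
  rw [dirDeriv, mvfderiv, h.mfderiv_eq, mfderiv_const]
  rfl

section

variable {d n : ℕ} {M N : Type*}
  [TopologicalSpace M] [ChartedSpace (EuclideanSpace ℝ (Fin d)) M] [IsManifold (𝓡 d) ∞ M]
  [TopologicalSpace N] [ChartedSpace (EuclideanSpace ℝ (Fin n)) N] [IsManifold (𝓡 n) ∞ N]

/-- Two vertical vectors of a submersion extend to commuting vertical vector fields. -/
theorem exists_commuting_vertical_fields {F : M → N} {p : M}
    (hF : ContMDiff (𝓡 d) (𝓡 n) ∞ F)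
    (hsurj : Function.Surjective (mfderiv (𝓡 d) (𝓡 n) F p))
    {v w : Tan d p} (hv : v ∈ verticalSpace d n F p) (hw : w ∈ verticalSpace d n F p) :
    ∃ X Y : (q : M) → Tan d q, SmoothFieldAt X p ∧ SmoothFieldAt Y p ∧ X p = v ∧ Y p = w ∧
      (∀ᶠ q in 𝓝 p, X q ∈ verticalSpace d n F q) ∧
      (∀ᶠ q in 𝓝 p, Y q ∈ verticalSpace d n F q) ∧
      mlieBracket (𝓡 d) X Y p = 0 := by
  have : IsManifold (𝓡 d) (minSmoothness ℝ 3) M :=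
    IsManifold.of_le (n := ∞) (by simp; exact ENat.LEInfty.out)
  have hchart {q : M} (hq : F q ∈ (extChartAt (𝓡 n) (F p)).source) :
      mfderiv (𝓡 d) 𝓘(ℝ, EuclideanSpace ℝ (Fin n)) (extChartAt (𝓡 n) (F p) ∘ F) q =
        (mfderiv (𝓡 n) 𝓘(ℝ, EuclideanSpace ℝ (Fin n)) (extChartAt (𝓡 n) (F p)) (F q)).comp
          (mfderiv (𝓡 d) (𝓡 n) F q) :=
    mfderiv_comp q (mdifferentiableAt_extChartAt (by simpa using hq))
      (hF.mdifferentiable (by simp) q)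
  have hinv {q : M} (hq : F q ∈ (extChartAt (𝓡 n) (F p)).source) :=
    isInvertible_mfderiv_extChartAt (I := 𝓡 n) hq
  have hp : F p ∈ (extChartAt (𝓡 n) (F p)).source := mem_extChartAt_source _
  obtain ⟨Ψ, A, hΨ, hΨi, hAΨ⟩ := exists_coordinates_comp_eq
    (f := extChartAt (𝓡 n) (F p) ∘ F) (p := p)
    ((contMDiffAt_extChartAt (n := ∞)).comp p hF.contMDiffAt) (by
      rw [hchart hp]
      exact (hinv hp).bijective.surjective.comp hsurj)
  have hAd {q : M} (hq : MDifferentiableAt (𝓡 d) 𝓘(ℝ, EuclideanSpace ℝ (Fin d)) Ψ q)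
      (u : Tan d q) :
      A (mfderiv (𝓡 d) 𝓘(ℝ, EuclideanSpace ℝ (Fin d)) Ψ q u) =
        mfderiv (𝓡 d) 𝓘(ℝ, EuclideanSpace ℝ (Fin n)) (extChartAt (𝓡 n) (F p) ∘ F) q u := by
    have h := (A.hasMFDerivAt (x := Ψ q)).comp q hq.hasMFDerivAt
    rw [show A ∘ Ψ = extChartAt (𝓡 n) (F p) ∘ F from funext hAΨ] at h
    rw [h.mfderiv]
    rfl
  have hkey (u : Tan d p) (hu : u ∈ verticalSpace d n F p) :
      ∃ u' : EuclideanSpace ℝ (Fin d),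
        SmoothFieldAt (mpullback (𝓡 d) 𝓘(ℝ, EuclideanSpace ℝ (Fin d)) Ψ (constantField u')) p ∧
        mpullback (𝓡 d) 𝓘(ℝ, EuclideanSpace ℝ (Fin d)) Ψ (constantField u') p = u ∧
        ∀ᶠ q in 𝓝 p, mpullback (𝓡 d) 𝓘(ℝ, EuclideanSpace ℝ (Fin d)) Ψ (constantField u') q ∈
          verticalSpace d n F q := by
    refine ⟨mfderiv (𝓡 d) 𝓘(ℝ, EuclideanSpace ℝ (Fin d)) Ψ p u, ?_, ?_, ?_⟩
    · refine ContMDiffAt.mpullback_vectorField_preimage (m := ∞) (n := ∞) ?_ hΨ hΨi le_rfl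
      exact contMDiffAt_vectorSpace_iff_contDiffAt.2 contDiffAt_const
    · rw [mpullback_apply]
      exact hΨi.inverse_apply_eq.2 rfl
    · have hAu : A (mfderiv (𝓡 d) 𝓘(ℝ, EuclideanSpace ℝ (Fin d)) Ψ p u) = 0 := by
        rw [hAd (hΨ.mdifferentiableAt (by simp)), hchart hp]
        exact (congrArg (mfderiv (𝓡 n) 𝓘(ℝ, EuclideanSpace ℝ (Fin n))
          (extChartAt (𝓡 n) (F p)) (F p)) hu).trans (map_zero (mfderiv (𝓡 n)
            𝓘(ℝ, EuclideanSpace ℝ (Fin n)) (extChartAt (𝓡 n) (F p)) (F p)))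
      filter_upwards [hF.continuous.continuousAt.preimage_mem_nhds
        (extChartAt_source_mem_nhds (I := 𝓡 n) (F p))] with q hq
      change mfderiv (𝓡 d) (𝓡 n) F q _ = 0
      rw [mpullback_apply]
      by_cases hi : (mfderiv (𝓡 d) 𝓘(ℝ, EuclideanSpace ℝ (Fin d)) Ψ q).IsInvertible
      · apply (hinv hq).bijective.injective
        have h := hAd (mdifferentiableAt_of_isInvertible_mfderiv hi)
          ((mfderiv (𝓡 d) 𝓘(ℝ, EuclideanSpace ℝ (Fin d)) Ψ q).inverse
            (constantField (mfderiv (𝓡 d) 𝓘(ℝ, EuclideanSpace ℝ (Fin d)) Ψ p u) (Ψ q)))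
        rw [hi.self_apply_inverse, hchart hq] at h
        exact h.symm.trans (hAu.trans (map_zero (mfderiv (𝓡 n) 𝓘(ℝ, EuclideanSpace ℝ (Fin n))
          (extChartAt (𝓡 n) (F p)) (F q))).symm)
      · rw [ContinuousLinearMap.inverse_of_not_isInvertible hi]
        simp
  obtain ⟨v', hv₁, hv₂, hv₃⟩ := hkey v hv
  obtain ⟨w', hw₁, hw₂, hw₃⟩ := hkey w hw
  refine ⟨_, _, hv₁, hw₁, hv₂, hw₂, hv₃, hw₃, ?_⟩
  have hconst (u : EuclideanSpace ℝ (Fin d)) : MDifferentiableAt 𝓘(ℝ, EuclideanSpace ℝ (Fin d))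
      𝓘(ℝ, EuclideanSpace ℝ (Fin d)).tangent
      (fun x ↦ (⟨x, constantField u x⟩ : TangentBundle 𝓘(ℝ, EuclideanSpace ℝ (Fin d))
        (EuclideanSpace ℝ (Fin d)))) (Ψ p) :=
    (contMDiffAt_vectorSpace_iff_contDiffAt.2
      (contDiffAt_const (n := 1))).mdifferentiableAt one_ne_zero
  rw [← mpullback_mlieBracket (hconst v') (hconst w') hΨ
    (by simp; exact ENat.LEInfty.out), mpullback_apply, mlieBracket_constantField]
  exact map_zero _

/-- If the characteristic vector field of a `K`-(para)contact manifold is horizontal for a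
submersion, then `φ` maps vertical vectors to horizontal ones. -/
theorem IsKContact.mapsTo_horizontalSpace {ε : ℝ} {φ : (q : M) → Tan d q →L[ℝ] Tan d q}
    {ξ : (q : M) → Tan d q} {η : (q : M) → Tan d q →L[ℝ] ℝ} {g : SemiRiemannianMetric d M}
    (hM : IsKContact ε φ ξ η g) {F : M → N} (hF : ContMDiff (𝓡 d) (𝓡 n) ∞ F)
    (hξ : ∀ p : M, ξ p ∈ horizontalSpace n g F p) {p : M}
    (hsurj : Function.Surjective (mfderiv (𝓡 d) (𝓡 n) F p)) :
    Set.MapsTo (φ p) (verticalSpace d n F p) (horizontalSpace n g F p) := by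
  intro v hv w hw
  obtain ⟨X, Y, hX, hY, rfl, rfl, hXv, hYv, hXY⟩ := exists_commuting_vertical_fields hF hsurj hw hv
  have hη (q : M) (u : Tan d q) (hu : u ∈ verticalSpace d n F q) : η q u = 0 := by
    rw [hM.eta_eq, g.symm, hξ q u hu, mul_zero]
  rw [g.symm, ← hM.contact p X Y hX hY, extDerivOneForm, hXY,
    dirDeriv_eq_zero_of_eventually (hYv.mono fun q ↦ hη q _),
    dirDeriv_eq_zero_of_eventually (hXv.mono fun q ↦ hη q _)]
  simp

theorem IsLorentzianAlmostContact.eta_phi {ε : ℝ} {φ : (q : M) → Tan d q →L[ℝ] Tan d q}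
    {ξ : (q : M) → Tan d q} {η : (q : M) → Tan d q →L[ℝ] ℝ} {g : SemiRiemannianMetric d M}
    (hM : IsLorentzianAlmostContact ε φ ξ η g) (hε : ε ≠ 0) {p : M} {v : Tan d p}
    (hv : η p v = 0) : η p (φ p v) = 0 := by
  have h := hM.phi_phi p (φ p v)
  rw [hM.phi_phi p v, hv, zero_smul, add_zero, map_smul, left_eq_add] at h
  have h' := congrArg (η p) h
  rw [map_smul, hM.eta_xi, map_zero, smul_eq_mul] at h'
  simpa [hε] using h'

end

theorem mainTheorem9 {m n : ℕ} {M N : Type*}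
    [TopologicalSpace M] [ChartedSpace (EuclideanSpace ℝ (Fin (2 * m + 1))) M]
    [IsManifold (𝓡 (2 * m + 1)) ∞ M] [Nonempty M]
    [TopologicalSpace N] [ChartedSpace (EuclideanSpace ℝ (Fin n)) N] [IsManifold (𝓡 n) ∞ N]
    (ε : ℝ) (hε : ε = -1 ∨ ε = 1)
    (φ : (p : M) → Tan (2 * m + 1) p →L[ℝ] Tan (2 * m + 1) p)
    (ξ : (p : M) → Tan (2 * m + 1) p) (η : (p : M) → Tan (2 * m + 1) p →L[ℝ] ℝ)
    (gM : SemiRiemannianMetric (2 * m + 1) M) (gN : SemiRiemannianMetric n N)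
    (hM : IsKContact ε φ ξ η gM)
    (F : M → N) (hF : IsSemiRiemannianSubmersion gM gN F) (hsurj : Function.Surjective F)
    (hξ : ∀ p : M, ξ p ∈ horizontalSpace n gM F p) :
    IsAntiInvariantSubmersion φ gM gN F ∧ m + 1 ≤ n := by
  have hanti (p : M) := hM.mapsTo_horizontalSpace hF.contMDiff hξ (hF.surjective_mfderiv p)
  refine ⟨⟨hF, hanti⟩, ?_⟩
  have hε0 : ε ≠ 0 := by rcases hε with rfl | rfl <;> norm_num
  obtain ⟨p⟩ := ‹Nonempty M›
  let D : EuclideanSpace ℝ (Fin (2 * m + 1)) →ₗ[ℝ] EuclideanSpace ℝ (Fin n) :=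
    (mfderiv (𝓡 (2 * m + 1)) (𝓡 n) F p).toLinearMap
  let φ' : EuclideanSpace ℝ (Fin (2 * m + 1)) →ₗ[ℝ] EuclideanSpace ℝ (Fin (2 * m + 1)) :=
    (φ p).toLinearMap
  let T : D.ker × ℝ →ₗ[ℝ] EuclideanSpace ℝ (Fin (2 * m + 1)) :=
    (φ' ∘ₗ D.ker.subtype).coprod (LinearMap.toSpanSingleton ℝ _ (ξ p))
  have hη (u : Tan (2 * m + 1) p) (hu : u ∈ verticalSpace (2 * m + 1) n F p) : η p u = 0 := by
    rw [hM.eta_eq, gM.symm, hξ p u hu, mul_zero]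
  have hinj : Function.Injective (D ∘ₗ T) := by
    rw [← LinearMap.ker_eq_bot, LinearMap.ker_eq_bot']
    rintro ⟨⟨v, hv⟩, t⟩ h
    have hv : v ∈ verticalSpace (2 * m + 1) n F p := hv
    have hz : φ p v + t • ξ p = 0 := by
      refine hF.fibre_nondegenerate p _ h fun w hw ↦ ?_
      rw [map_add, map_smul, _root_.add_apply, _root_.smul_apply,
        hanti p hv w hw, hξ p w hw]
      simp
    have ht : t = 0 := by
      have h' := congrArg (η p) hz
      rw [map_add, map_smul, hM.eta_phi hε0 (hη v hv), hM.eta_xi, map_zero] at h'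
      simpa [hε0] using h'
    subst ht
    rw [zero_smul, add_zero] at hz
    have hv0 : v = 0 := by
      have h' := hM.phi_phi p v
      rw [hz, hη v hv, map_zero, zero_smul, add_zero] at h'
      exact (smul_eq_zero.1 h'.symm).resolve_left hε0
    subst hv0
    rfl
  have h₁ := LinearMap.finrank_le_finrank_of_injective hinj
  have h₂ := D.finrank_range_add_finrank_ker
  have h₃ : D.range = ⊤ := LinearMap.range_eq_top.2 (hF.surjective_mfderiv p)
  rw [h₃, finrank_top] at h₂
  simp only [Module.finrank_prod, Module.finrank_self, finrank_euclideanSpace_fin] at h₁ h₂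
  omega
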